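/- Let $\delta\in(0,1)$. There is a constant $C>0$, depending only on $\delta$, such that the following holds for all $d\in\mathbb N$, $R,B\in\mathbb R$ and $\varepsilon>0$. Let $\mathcal X_d\subseteq[-R,R]^d$ be compact, and let $k_d:\mathbb R^d\times\mathbb R^d\to\mathbb R$ be a continuous shift-invariant kernel (symmetric, positive semi-definite, $k_d(x+\xi,x'+\xi)=k_d(x,x')$; write $k_d(\Delta)=k_d(\Delta,0)$) with $k_d(0)=1$, whose second partial derivatives $\partial_i^2k_d(0)$ exist and satisfy $|\partial_i^2k_d(0)|\le B$ for $i=1,\dots,d$. Then there is exactly one probability measure $p_d$ on $\mathbb R^d$ with $k_d(\Delta)=\int e^{i\langle\omega,\Delta\rangle}\,\mathrm dp_d(\omega)$ (the inverse Fourier transform of $k_d$). Moreover, for every even integer $D\ge2$ with $$D\;\ge\; C\,\frac{d}{\varepsilon^2}\,\log\max\Big\{2,\frac{Rd\sqrt B}{\varepsilon}\Big\},$$ draw $\omega_1,\dots,\omega_{D/2}$ independently from $p_d$ and let $$z(x)=\sqrt{2/D}\,\big(\cos\langle\omega_1,x\rangle,\sin\langle\omega_1,x\rangle,\dots,\cos\langle\omega_{D/2},x\rangle,\sin\langle\omega_{D/2},x\rangle\big)\in\mathbb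 R^D$$ be the random Fourier feature map. Put $n=\lceil\log_4(D+1)\rceil$ and $g(x)=\|z(x)\|_1$, let $P_1,\dots,P_{4^n-1}$ be the non-identity Pauli words on $n$ qubits, let $r(x)=z(x)/g(x)$, padded with zeros to length $4^n-1$, and let $\rho(x)$ be the state obtained by preparing $2^{-n}(\mathbb I+\operatorname{sign}(r_i(x))P_i)$ with probability $|r_i(x)|$, i.e. $\rho(x)=\sum_i|r_i(x)|\,2^{-n}(\mathbb I+\operatorname{sign}(r_i(x))P_i)$. Then: 1. with probability at least $1-\delta$, for all $x,x'\in\mathcal X_d$ both $|\langle z(x),z(x')\rangle-k_d(x-x')|<\varepsilon$ and $\big|g(x)g(x')\big(2^n\operatorname{Tr}\{\rho(x)\rho(x')\}-1\big)-k_d(x-x')\big|<\varepsilon$; 2. $\rho(x)$ is a density operator on $n$ qubits for every $x\in\mathbb R^d$ and every choice of the $\omega_i$, so that $\operatorname{Tr}\{\rho(x)\rho(x')\}$ is an embedding quantum kernel; 3. $n\le 2\log D$. In particular, for any constant success probability, random Fourier features $\varepsilon$-approximate $k_d$ as an explicit inner product of dimension $D\in\mathcal O\big(\frac{d}{\varepsilon^2}\log\frac{Rd\sqrt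 B}{\varepsilon}\big)$, and this becomes an embedding quantum kernel on $\mathcal O(\log D)$ qubits. -/

import Mathlib

open MeasureTheory Filter Topology
open scoped ComplexOrder

noncomputable section

namespace QKernel

/-- `ℝ^d` with its Euclidean inner product. -/
abbrev Vec (d : ℕ) : Type := EuclideanSpace ℝ (Fin d)

/-- A (real) kernel function: symmetric and positive semi-definite. -/
structure IsKernel {𝒳 : Type*} (k : 𝒳 → 𝒳 → ℝ) : Prop where
  symm : ∀ x x', k x x' = k x' x
  psd : ∀ (m : ℕ) (x : Fin m → 𝒳) (a : Fin m → ℝ), 0 ≤ ∑ i, ∑ j, a i * a j * k (x i) (x j)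

/-- Shift invariance. The function of one argument `Δ = x - x'` is then `fun Δ => k Δ 0`. -/
def IsShiftInvariant {d : ℕ} (k : Vec d → Vec d → ℝ) : Prop :=
  ∀ x x' ξ, k (x + ξ) (x' + ξ) = k x x'

/-- The restriction of `Δ ↦ k Δ 0` to the `i`-th coordinate axis. -/
def axisRestriction {d : ℕ} (k : Vec d → Vec d → ℝ) (i : Fin d) (t : ℝ) : ℝ :=
  k (EuclideanSpace.single i t) 0

/-- The second partial derivative `∂ᵢ² k` exists at the origin and is equal to `b`. -/
def HasSecondPartialAtZero {d : ℕ} (k : Vec d → Vec d → ℝ) (i : Fin d) (b : ℝ) : Prop :=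
  (∀ᶠ t in 𝓝 (0 : ℝ), DifferentiableAt ℝ (axisRestriction k i) t) ∧
    HasDerivAt (deriv (axisRestriction k i)) b 0

/-- `p` is a probability measure whose Fourier transform `Δ ↦ ∫ exp (i ⟨ω, Δ⟩) dp(ω)` is `k`,
that is, `p` is the inverse Fourier transform of `k`. -/
def IsInverseFT {d : ℕ} (k : Vec d → Vec d → ℝ) (p : Measure (Vec d)) : Prop :=
  IsProbabilityMeasure p ∧ ∀ Δ : Vec d, charFun p Δ = (k Δ 0 : ℂ)

/-- The random Fourier feature map in dimension `D = 2 * m` for the frequencies `ω₁, …, ωₘ`: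
`z(x) = √(2/D) (cos⟨ω₁,x⟩, sin⟨ω₁,x⟩, …, cos⟨ωₘ,x⟩, sin⟨ωₘ,x⟩)`. -/
def rff {d m : ℕ} (ω : Fin m → Vec d) (x : Vec d) : Vec (2 * m) :=
  WithLp.toLp 2 fun j =>
    √(2 / ((2 * m : ℕ) : ℝ)) *
      (if (j : ℕ) % 2 = 0 then Real.cos (inner ℝ (ω ⟨(j : ℕ) / 2, by omega⟩) x)
        else Real.sin (inner ℝ (ω ⟨(j : ℕ) / 2, by omega⟩) x))

/-- `s` is an `ε`-approximation of `k` in supremum norm on the domain `X`. -/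
def IsApproxOn {d : ℕ} (X : Set (Vec d)) (s k : Vec d → Vec d → ℝ) (ε : ℝ) : Prop :=
  ∀ x ∈ X, ∀ x' ∈ X, |s x x' - k x x'| < ε

/-- The four single-qubit Pauli matrices `𝟙, X, Y, Z`. -/
def pauli : Fin 4 → Matrix (Fin 2) (Fin 2) ℂ :=
  ![1, !![0, 1; 1, 0], !![0, -Complex.I; Complex.I, 0], !![1, 0; 0, -1]]

/-- Operators on `n` qubits; the computational basis is indexed by `Fin n → Fin 2`. -/
abbrev QubitOp (n : ℕ) : Type := Matrix (Fin n → Fin 2) (Fin n → Fin 2) ℂ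

/-- The Pauli word `pauli (s 0) ⊗ ⋯ ⊗ pauli (s (n - 1))`, by the entries of the tensor product. -/
def pauliWord {n : ℕ} (s : Fin n → Fin 4) : QubitOp n :=
  Matrix.of fun a b => ∏ q, pauli (s q) (a q) (b q)

/-- The enumeration `P₁, …, P_{4^n - 1}` of the Pauli words other than the identity: the letters
of `P_i` are the base-4 digits of `i` (and `i = 0` would be the identity). The index is shifted
by one, as `Fin` starts at zero. -/
def nonIdPauli (n : ℕ) (i : Fin (4 ^ n - 1)) : QubitOp n :=
  pauliWord (finFunctionFinEquiv.symm ⟨(i : ℕ) + 1, Nat.add_lt_of_lt_sub i.isLt⟩)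

/-- The 1-norm of a vector. -/
def oneNorm {D : ℕ} (r : Fin D → ℝ) : ℝ := ∑ j, |r j|

/-- The number of qubits `⌈log₄ (D + 1)⌉` that encodes a vector of length `D`. -/
def numQubits (D : ℕ) : ℕ := Nat.clog 4 (D + 1)

/-- Padding a vector with zeros to the length `4 ^ n - 1`. -/
def pad {D : ℕ} (n : ℕ) (r : Fin D → ℝ) (i : Fin (4 ^ n - 1)) : ℝ :=
  if h : (i : ℕ) < D then r ⟨i, h⟩ else 0

/-- The state prepared by the classical-to-quantum embedding of `r`, a unit vector in the 1-norm:
the mixture in which `(𝟙 + sign (rᵢ) Pᵢ) / 2^n` is prepared with probability `|rᵢ|`. -/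
def c2qe {D : ℕ} (r : Fin D → ℝ) : QubitOp (numQubits D) :=
  ∑ i, ((|pad (numQubits D) r i| : ℝ) : ℂ) •
    ((1 / 2 ^ numQubits D : ℂ) •
      (1 + ((SignType.sign (pad (numQubits D) r i) : ℝ) : ℂ) • nonIdPauli (numQubits D) i))

/-- Density operators on `n` qubits. -/
def IsDensity {n : ℕ} (ρ : QubitOp n) : Prop := ρ.PosSemidef ∧ ρ.trace = 1

/-- The embedding quantum kernel `Tr (ρ(x) ρ(x'))` of a data embedding `ρ`. -/
def eqk {𝒳 : Type*} {n : ℕ} (ρ : 𝒳 → QubitOp n) (x x' : 𝒳) : ℝ := ((ρ x * ρ x').trace).re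

/-- The quantum random Fourier feature map: the embedding of the 1-normalized `z(x)`. -/
def qrff {d m : ℕ} (ω : Fin m → Vec d) (x : Vec d) : QubitOp (numQubits (2 * m)) :=
  c2qe fun j => rff ω x j / oneNorm (rff ω x)

/-- The kernel evaluated from the embedding quantum kernel of `qrff`, with the prefactors
`g(x) g(x') (2^n Tr (ρ(x) ρ(x')) - 1)`, `g(x) = ‖z(x)‖₁`. -/
def qrffKernel {d m : ℕ} (ω : Fin m → Vec d) (x x' : Vec d) : ℝ :=
  oneNorm (rff ω x) * oneNorm (rff ω x') * (2 ^ numQubits (2 * m) * eqk (qrff ω) x x' - 1)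

end QKernel

end

open QKernel

/-! By Bochner's theorem a normalized continuous positive semi-definite function `φ` on `ℝ^d` is a
characteristic function. Averaging the form `∑ φ (xᵢ - xⱼ) ≥ 0` over independent Gaussian points
`xᵢ` shows that `φ` has nonnegative integral against every centred Gaussian density. Multiplying `φ`
by a character shows the same for the Fourier transform of `φ` damped by a Gaussian, so each damped
`φ` is the characteristic function of a probability measure, and tightness removes the damping.

The inner product of the random Fourier features at `x` and `x'` is the empirical mean of
`cos ⟨ω, x - x'⟩`. Hoeffding's inequality controls its deviation from `k (x - x')` on a grid of
differences. Between grid points the deviation is at most the mesh times the empirical mean of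
`∑ |ωᵢ|` plus its expectation; this is small by Markov's inequality, since by Fatou's lemma
`E[ωᵢ²] ≤ -∂ᵢ² k(0) ≤ B`.

The non-identity Pauli words are traceless and orthogonal for the trace form, which makes
`2^n Tr (ρ(x) ρ(x')) - 1` the inner product of the normalized feature vectors: the quantum kernel
computes the inner product of random Fourier features exactly. -/

namespace QKernel

open scoped FourierTransform

section Sampling

variable {Ω : Type*} [MeasurableSpace Ω] {μ : Measure Ω} [IsProbabilityMeasure μ]

theorem integral_pi_comp_pair {ι E : Type*} [Fintype ι] [NormedAddCommGroup E] [NormedSpace ℝ E]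
    {i j : ι} (hij : i ≠ j) {K : Ω × Ω → E} (hK : AEStronglyMeasurable K (μ.prod μ)) :
    ∫ x, K (x i, x j) ∂(Measure.pi fun _ : ι => μ) = ∫ z, K z ∂(μ.prod μ) := by
  have hind := (ProbabilityTheory.iIndepFun_pi (μ := fun _ : ι => μ) (X := fun _ => id)
    (fun _ => aemeasurable_id)).indepFun hij
  have hmap := (ProbabilityTheory.indepFun_iff_map_prod_eq_prod_map_map
    (measurable_pi_apply i).aemeasurable (measurable_pi_apply j).aemeasurable).1 hind
  have heval (i : ι) : (Measure.pi fun _ : ι => μ).map (fun x => x i) = μ :=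
    (measurePreserving_eval (fun _ : ι => μ) i).map_eq
  simp only [heval] at hmap
  rw [← hmap] at hK ⊢
  rw [integral_map (by fun_prop) hK]

theorem sum_integral_pi_comp_pair {E : Type*} [NormedAddCommGroup E] [NormedSpace ℝ E] (n : ℕ)
    {K : Ω × Ω → E} (hK : StronglyMeasurable K) :
    ∑ i, ∑ j, ∫ x, K (x i, x j) ∂(Measure.pi fun _ : Fin n => μ) =
      (n * n : ℝ) • ∫ z, K z ∂(μ.prod μ) +
        (n : ℝ) • (∫ x, K (x, x) ∂μ - ∫ z, K z ∂(μ.prod μ)) := by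
  have hterm (i j : Fin n) : ∫ x, K (x i, x j) ∂(Measure.pi fun _ : Fin n => μ) =
      ∫ z, K z ∂(μ.prod μ) + if i = j then ∫ x, K (x, x) ∂μ - ∫ z, K z ∂(μ.prod μ) else 0 := by
    split_ifs with hij
    · subst hij
      rw [add_sub_cancel, integral_comp_eval (μ := fun _ : Fin n => μ) (f := fun x => K (x, x))
        (hK.comp_measurable (by fun_prop)).aestronglyMeasurable]
    · rw [integral_pi_comp_pair hij hK.aestronglyMeasurable, add_zero]
  simp only [hterm, Finset.sum_add_distrib, Finset.sum_const, Finset.card_univ, Fintype.card_fin,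
    Finset.sum_ite_eq, Finset.mem_univ, if_true, ← Nat.cast_smul_eq_nsmul ℝ, smul_smul]

theorem integral_prod_nonneg_of_sum_nonneg {K : Ω × Ω → ℂ} (hK : StronglyMeasurable K) {M : ℝ}
    (hM : ∀ z, ‖K z‖ ≤ M) (hpos : ∀ (n : ℕ) (x : Fin n → Ω), 0 ≤ ∑ i, ∑ j, K (x i, x j)) :
    0 ≤ ∫ z, K z ∂(μ.prod μ) := by
  set J := ∫ z, K z ∂(μ.prod μ)
  set T := ∫ x, K (x, x) ∂μ
  have hsample (n : ℕ) : 0 ≤ (n * n : ℝ) • J + (n : ℝ) • (T - J) := by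
    have hint (i j : Fin n) :
        Integrable (fun x : Fin n → Ω => K (x i, x j)) (Measure.pi fun _ => μ) :=
      .of_bound (hK.comp_measurable (by fun_prop)).aestronglyMeasurable M
        (ae_of_all _ fun _ => hM _)
    rw [← sum_integral_pi_comp_pair n hK]
    simp_rw [← integral_finsetSum _ fun j _ => hint _ j]
    rw [← integral_finsetSum _ fun i _ => integrable_finsetSum _ fun j _ => hint i j]
    exact integral_nonneg fun x => hpos n x
  have hscaled (n : ℕ) : 0 ≤ J + (1 / ((n : ℝ) + 1)) • (T - J) := by
    have hn : (n : ℝ) + 1 ≠ 0 := n.cast_add_one_ne_zero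
    convert smul_nonneg (by positivity : (0 : ℝ) ≤ (((n : ℝ) + 1) ^ 2)⁻¹) (hsample (n + 1)) using 1
    rw [smul_add, smul_smul, smul_smul, Nat.cast_add_one, ← pow_two,
      inv_mul_cancel₀ (by positivity), one_smul]
    congr 2
    field_simp
  have hlim : Tendsto (fun n : ℕ => J + (1 / ((n : ℝ) + 1)) • (T - J)) atTop (𝓝 J) := by
    simpa using ((tendsto_one_div_add_atTop_nhds_zero_nat (𝕜 := ℝ)).smul_const (T - J)).const_add J
  exact ge_of_tendsto' hlim hscaled

end Sampling

/-- Positive semi-definite functions on a group, in the complex-valued sense of Bochner's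
theorem. -/
def IsPosSemidefFun {G : Type*} [AddGroup G] (φ : G → ℂ) : Prop :=
  ∀ (n : ℕ) (x : Fin n → G), (Matrix.of fun i j => φ (x i - x j)).PosSemidef

namespace IsPosSemidefFun

section AddGroup

variable {G : Type*} [AddGroup G] {φ : G → ℂ}

theorem sum_nonneg (h : IsPosSemidefFun φ) (n : ℕ) (x : Fin n → G) :
    0 ≤ ∑ i, ∑ j, φ (x i - x j) := by
  simpa [dotProduct, Matrix.mulVec] using (h n x).dotProduct_mulVec_nonneg fun _ => 1

theorem map_neg (h : IsPosSemidefFun φ) (x : G) : φ (-x) = star (φ x) := by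
  simpa using ((h 2 ![x, 0]).isHermitian.apply 1 0).symm

theorem norm_le (h : IsPosSemidefFun φ) (x : G) : ‖φ x‖ ≤ ‖φ 0‖ := by
  have hdet := (h 2 ![x, 0]).det_nonneg
  have h0 : star (φ 0) = φ 0 := by simpa using (h.map_neg 0).symm
  have hmul : ‖φ x‖ ^ 2 ≤ ‖φ 0‖ ^ 2 := by
    have : (‖φ x‖ ^ 2 : ℂ) ≤ ‖φ 0‖ ^ 2 := by
      rw [← Complex.mul_conj', ← Complex.mul_conj', starRingEnd_apply, starRingEnd_apply, h0,
        ← h.map_neg]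
      simpa [Matrix.det_fin_two] using hdet
    exact_mod_cast this
  exact pow_le_pow_iff_left₀ (norm_nonneg _) (norm_nonneg _) two_ne_zero |>.1 hmul

theorem mul_of_map_sub_eq {χ : G → ℂ} (h : IsPosSemidefFun φ)
    (hχ : ∀ x y, χ (x - y) = χ x * star (χ y)) : IsPosSemidefFun fun x => χ x * φ x := by
  intro n x
  convert (h n x).conjTranspose_mul_mul_same (Matrix.diagonal fun i => star (χ (x i))) using 1
  ext i j
  simp only [Matrix.of_apply, hχ, Matrix.diagonal_conjTranspose, Matrix.mul_diagonal,
    Matrix.diagonal_mul, Pi.star_apply, star_star]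
  ring

end AddGroup

end IsPosSemidefFun

section Gaussian

variable {V : Type*} [NormedAddCommGroup V] [InnerProductSpace ℝ V] [MeasurableSpace V]
  [BorelSpace V]

theorem charFun_map_sub_prod [SecondCountableTopology V] {μ ν : Measure V} [SFinite μ] [SFinite ν]
    (t : V) :
    charFun ((μ.prod ν).map fun z => z.1 - z.2) t = charFun μ t * charFun ν (-t) := by
  simp_rw [charFun_apply]
  rw [integral_map (by fun_prop) (by fun_prop), ← integral_prod_mul]
  congr with z
  rw [← Complex.exp_add, inner_sub_left, inner_neg_right]
  push_cast
  ring_nf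

variable [FiniteDimensional ℝ V] {b : ℝ}

theorem integrable_exp_neg_mul_sq_norm (hb : 0 < b) :
    Integrable fun v : V => Real.exp (-b * ‖v‖ ^ 2) := by
  refine (GaussianFourier.integrable_cexp_neg_mul_sq_norm_add (b := (b : ℂ))
    (by simpa using hb) 0 (0 : V)).re.congr (ae_of_all _ fun v => ?_)
  simp only [zero_mul, add_zero]
  norm_cast

theorem isProbabilityMeasure_tilted_neg_mul_sq_norm (hb : 0 < b) :
    IsProbabilityMeasure ((volume : Measure V).tilted fun v => -b * ‖v‖ ^ 2) :=
  isProbabilityMeasure_tilted (integrable_exp_neg_mul_sq_norm hb)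

theorem charFun_tilted_neg_mul_sq_norm (hb : 0 < b) (t : V) :
    charFun ((volume : Measure V).tilted fun v => -b * ‖v‖ ^ 2) t =
      Complex.exp (-‖t‖ ^ 2 / (4 * b)) := by
  have hb' : 0 < (b : ℂ).re := hb
  have hmass := GaussianFourier.integral_cexp_neg_mul_sq_norm (V := V) hb'
  have hexp (v : V) : Complex.exp (-b * ‖v‖ ^ 2) = Real.exp (-b * ‖v‖ ^ 2) := by push_cast; rfl
  have hshift := GaussianFourier.integral_cexp_neg_mul_sq_norm_add hb' Complex.I t
  simp_rw [Complex.exp_add, Complex.I_sq, hexp] at hshift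
  simp_rw [hexp, integral_complex_ofReal] at hmass
  have hmass0 : ((∫ v : V, Real.exp (-b * ‖v‖ ^ 2) : ℝ) : ℂ) ≠ 0 :=
    Complex.ofReal_ne_zero.2 (integral_exp_pos (integrable_exp_neg_mul_sq_norm hb)).ne'
  rw [charFun_apply, integral_tilted]
  simp_rw [Complex.real_smul, Complex.ofReal_div, div_mul_eq_mul_div, integral_div,
    mul_comm (_ : ℂ) Complex.I, real_inner_comm t]
  rw [hshift, ← hmass, mul_div_cancel_left₀ _ hmass0, neg_one_mul]

theorem map_sub_prod_tilted_neg_mul_sq_norm (hb : 0 < b) :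
    (((volume : Measure V).tilted fun v => -(2 * b) * ‖v‖ ^ 2).prod
      ((volume : Measure V).tilted fun v => -(2 * b) * ‖v‖ ^ 2)).map (fun z => z.1 - z.2) =
        (volume : Measure V).tilted fun v => -b * ‖v‖ ^ 2 := by
  have hb2 : 0 < 2 * b := by positivity
  have := isProbabilityMeasure_tilted_neg_mul_sq_norm (V := V) hb
  have := isProbabilityMeasure_tilted_neg_mul_sq_norm (V := V) hb2
  refine Measure.ext_of_charFun (funext fun t => ?_)
  rw [charFun_map_sub_prod, charFun_tilted_neg_mul_sq_norm hb2, charFun_tilted_neg_mul_sq_norm hb2,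
    charFun_tilted_neg_mul_sq_norm hb, ← Complex.exp_add, norm_neg]
  have : (b : ℂ) ≠ 0 := Complex.ofReal_ne_zero.2 hb.ne'
  congr 1
  push_cast
  field_simp
  norm_num

end Gaussian

namespace IsPosSemidefFun

variable {V : Type*} [NormedAddCommGroup V] [InnerProductSpace ℝ V] [FiniteDimensional ℝ V]
  [MeasurableSpace V] [BorelSpace V] {φ : V → ℂ} {b : ℝ}

theorem integral_gaussian_smul_nonneg (h : IsPosSemidefFun φ) (hc : Continuous φ) (hb : 0 < b) :
    0 ≤ ∫ v, Real.exp (-b * ‖v‖ ^ 2) • φ v := by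
  have := isProbabilityMeasure_tilted_neg_mul_sq_norm (V := V) (b := 2 * b) (by positivity)
  have htilted : 0 ≤ ∫ v, φ v ∂(volume.tilted fun v => -b * ‖v‖ ^ 2) := by
    rw [← map_sub_prod_tilted_neg_mul_sq_norm hb,
      integral_map (by fun_prop) hc.aestronglyMeasurable]
    exact integral_prod_nonneg_of_sum_nonneg
      (hc.comp (continuous_fst.sub continuous_snd)).stronglyMeasurable (fun z => h.norm_le _)
      h.sum_nonneg
  have hmass := integral_exp_pos (integrable_exp_neg_mul_sq_norm (V := V) hb)
  simp_rw [integral_tilted, div_eq_inv_mul, mul_smul, integral_smul] at htilted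
  exact (smul_nonneg_iff_nonneg_of_pos_left (inv_pos.2 hmass)).1 htilted

theorem fourier_gaussian_smul_nonneg (h : IsPosSemidefFun φ) (hc : Continuous φ) (hb : 0 < b)
    (w : V) : 0 ≤ 𝓕 (fun v => Real.exp (-b * ‖v‖ ^ 2) • φ v) w := by
  have hmod : IsPosSemidefFun fun v => (𝐞 (-inner ℝ v w) : ℂ) * φ v :=
    h.mul_of_map_sub_eq fun x y => by
      rw [inner_sub_left, neg_sub', AddChar.map_sub_eq_div, div_eq_mul_inv, Circle.coe_mul,
        Circle.coe_inv_eq_conj]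
      rfl
  refine (hmod.integral_gaussian_smul_nonneg (by fun_prop) hb).trans_eq ?_
  simp_rw [Real.fourier_eq, Circle.smul_def, smul_eq_mul, mul_smul_comm]

theorem integrable_gaussian_smul (h : IsPosSemidefFun φ) (hc : Continuous φ) (hb : 0 < b) :
    Integrable fun v => Real.exp (-b * ‖v‖ ^ 2) • φ v :=
  (integrable_exp_neg_mul_sq_norm hb).smul_bdd ‖φ 0‖ hc.aestronglyMeasurable
    (ae_of_all _ h.norm_le)

end IsPosSemidefFun

section Fatou

variable {Ω : Type*} [MeasurableSpace Ω] {μ : Measure Ω} {f : ℕ → Ω → ℝ} {g : Ω → ℝ} {L : ℝ}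

theorem lintegral_ofReal_le_of_tendsto_integral (hf : ∀ n, Integrable (f n) μ)
    (hpos : ∀ n, 0 ≤ f n) (hlim : ∀ x, Tendsto (fun n => f n x) atTop (𝓝 (g x)))
    (hL : Tendsto (fun n => ∫ x, f n x ∂μ) atTop (𝓝 L)) :
    ∫⁻ x, ENNReal.ofReal (g x) ∂μ ≤ ENNReal.ofReal L :=
  calc ∫⁻ x, ENNReal.ofReal (g x) ∂μ
      = ∫⁻ x, liminf (fun n => ENNReal.ofReal (f n x)) atTop ∂μ :=
        lintegral_congr fun x => ((ENNReal.tendsto_ofReal (hlim x)).liminf_eq).symm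
    _ ≤ liminf (fun n => ∫⁻ x, ENNReal.ofReal (f n x) ∂μ) atTop :=
        lintegral_liminf_le' fun n => (hf n).1.aemeasurable.ennreal_ofReal
    _ = ENNReal.ofReal L := by
        simp_rw [← ofReal_integral_eq_lintegral_ofReal (hf _) (ae_of_all _ (hpos _))]
        exact (ENNReal.tendsto_ofReal hL).liminf_eq

theorem integrable_and_integral_le_of_tendsto_integral (hf : ∀ n, Integrable (f n) μ)
    (hpos : ∀ n, 0 ≤ f n) (hlim : ∀ x, Tendsto (fun n => f n x) atTop (𝓝 (g x)))
    (hL : Tendsto (fun n => ∫ x, f n x ∂μ) atTop (𝓝 L)) :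
    Integrable g μ ∧ ∫ x, g x ∂μ ≤ L := by
  have hle := lintegral_ofReal_le_of_tendsto_integral hf hpos hlim hL
  have hg0 : 0 ≤ᵐ[μ] g := ae_of_all _ fun x => ge_of_tendsto' (hlim x) fun n => hpos n x
  have hL0 : 0 ≤ L := ge_of_tendsto' hL fun n => integral_nonneg (hpos n)
  have hgm : AEStronglyMeasurable g μ :=
    aestronglyMeasurable_of_tendsto_ae _ (fun n => (hf n).1) (ae_of_all _ hlim)
  refine ⟨⟨hgm, ?_⟩, ?_⟩
  · rw [hasFiniteIntegral_iff_ofReal hg0]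
    exact hle.trans_lt ENNReal.ofReal_lt_top
  · rw [integral_eq_lintegral_of_nonneg_ae hg0 hgm]
    exact ENNReal.toReal_le_of_le_ofReal hL0 hle

end Fatou

theorem continuous_charFun_apply {V : Type*} [NormedAddCommGroup V] [InnerProductSpace ℝ V]
    [MeasurableSpace V] [OpensMeasurableSpace V] (t : V) :
    Continuous fun ρ : ProbabilityMeasure V => charFun (ρ : Measure V) t := by
  simp_rw [charFun_eq_integral_innerProbChar]
  exact continuous_iff_continuousAt.2 fun ρ =>
    (ProbabilityMeasure.tendsto_iff_forall_integral_rclike_tendsto ℂ).1 tendsto_id _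

section Fourier

variable {V : Type*} [NormedAddCommGroup V] [InnerProductSpace ℝ V] [FiniteDimensional ℝ V]
  [MeasurableSpace V] [BorelSpace V]

theorem tendsto_exp_neg_inv_mul (s : ℝ) :
    Tendsto (fun n : ℕ => Real.exp (-(n + 1 : ℝ)⁻¹ * s)) atTop (𝓝 1) := by
  have hinv : Tendsto (fun n : ℕ => (n + 1 : ℝ)⁻¹) atTop (𝓝 0) := by
    simpa using tendsto_one_div_add_atTop_nhds_zero_nat (𝕜 := ℝ)
  simpa using ((hinv.neg.mul_const s)).rexp

theorem tendsto_integral_gaussian_smul_fourier {E : Type*} [NormedAddCommGroup E]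
    [NormedSpace ℂ E] [CompleteSpace E] {f : V → E} (hf : Integrable f) (hf0 : ContinuousAt f 0) :
    Tendsto (fun c : ℝ => ∫ w, Real.exp (-c⁻¹ * ‖w‖ ^ 2) • 𝓕 f w) atTop (𝓝 (f 0)) := by
  refine (Real.tendsto_integral_gaussian_smul' hf hf0).congr' ?_
  filter_upwards [eventually_gt_atTop 0] with c hc
  have hc' : 0 < ((c : ℂ)⁻¹).re := by rw [← Complex.ofReal_inv]; exact inv_pos.2 hc
  have hgauss : Integrable fun w : V => Complex.exp (-(c : ℂ)⁻¹ * ‖w‖ ^ 2) := by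
    simpa using (integrable_exp_neg_mul_sq_norm (V := V) (inv_pos.2 hc)).ofReal (𝕜 := ℂ)
  have hflip := VectorFourier.integral_fourierIntegral_smul_eq_flip (L := innerₗ V)
    Real.continuous_fourierChar continuous_inner hgauss hf
  rw [flip_innerₗ] at hflip
  change ∫ w, 𝓕 (fun w : V => Complex.exp (-(c : ℂ)⁻¹ * ‖w‖ ^ 2)) w • f w =
    ∫ w, Complex.exp (-(c : ℂ)⁻¹ * ‖w‖ ^ 2) • 𝓕 f w at hflip
  simp_rw [fourier_gaussian_innerProductSpace hc'] at hflip
  simp only [div_inv_eq_mul] at hflip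
  convert hflip using 3 with w w
  · rw [zero_sub, norm_neg, mul_right_comm]
  · rw [← Complex.coe_smul]
    push_cast
    rfl

theorem continuous_fourier {E : Type*} [NormedAddCommGroup E] [NormedSpace ℂ E] {f : V → E}
    (hf : Integrable f) : Continuous (𝓕 f) :=
  VectorFourier.fourierIntegral_continuous Real.continuous_fourierChar (L := innerₗ V)
    continuous_inner hf

variable {f : V → ℂ}

theorem integrable_fourier_of_nonneg (hf : Integrable f) (hf0 : ContinuousAt f 0)
    (hpos : ∀ w, 0 ≤ 𝓕 f w) : Integrable (𝓕 f) := by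
  have hcont := continuous_fourier hf
  have hbound (w : V) : ‖𝓕 f w‖ ≤ ∫ v, ‖f v‖ :=
    VectorFourier.norm_fourierIntegral_le_integral_norm _ _ (innerₗ V) f w
  have hint (n : ℕ) : Integrable fun w : V => Real.exp (-(n + 1 : ℝ)⁻¹ * ‖w‖ ^ 2) • 𝓕 f w :=
    (integrable_exp_neg_mul_sq_norm (inv_pos.2 n.cast_add_one_pos)).smul_bdd _
      hcont.aestronglyMeasurable (ae_of_all _ hbound)
  have hlim : Tendsto (fun n : ℕ => ∫ w : V, (Real.exp (-(n + 1 : ℝ)⁻¹ * ‖w‖ ^ 2) • 𝓕 f w).re)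
      atTop (𝓝 (f 0).re) := by
    have h := (Complex.continuous_re.tendsto _).comp <|
      (tendsto_integral_gaussian_smul_fourier hf hf0).comp
        (tendsto_atTop_add_const_right _ (1 : ℝ) tendsto_natCast_atTop_atTop)
    exact h.congr fun n => (integral_re (hint n)).symm
  have hre : Integrable fun w => (𝓕 f w).re :=
    (integrable_and_integral_le_of_tendsto_integral (fun n => (hint n).re)
      (fun n w => (Complex.nonneg_iff.1 (smul_nonneg (Real.exp_pos _).le (hpos w))).1)
      (fun w => (Complex.continuous_re.tendsto' _ _ (by rw [one_smul])).comp
        ((tendsto_exp_neg_inv_mul (‖w‖ ^ 2)).smul_const (𝓕 f w))) hlim).1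
  exact hre.ofReal.congr (ae_of_all _ fun w => (Complex.eq_re_of_ofReal_le (hpos w)).symm)

theorem charFun_withDensity_fourier (hfc : Continuous f) (hf : Integrable f)
    (hpos : ∀ w, 0 ≤ 𝓕 f w) (t : V) :
    charFun (volume.withDensity fun w => ENNReal.ofReal (𝓕 f w).re) ((2 * Real.pi) • t) = f t := by
  have hcont := continuous_fourier hf
  rw [← congrFun (hfc.fourierInv_fourier_eq hf (integrable_fourier_of_nonneg hf hfc.continuousAt
    hpos)) t, Real.fourierInv_eq', charFun_apply, integral_withDensity_eq_integral_toReal_smul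
    (by fun_prop) (ae_of_all _ fun _ => ENNReal.ofReal_lt_top)]
  congr with w
  have hre : ((𝓕 f w).re : ℂ) = 𝓕 f w := (Complex.eq_re_of_ofReal_le (hpos w)).symm
  rw [ENNReal.toReal_ofReal (Complex.nonneg_iff.1 (hpos w)).1, ← Complex.coe_smul, hre,
    smul_eq_mul, smul_eq_mul, mul_comm, inner_smul_right]

theorem exists_charFun_eq_of_fourier_nonneg (hfc : Continuous f) (hf : Integrable f)
    (hpos : ∀ w, 0 ≤ 𝓕 f w) (h0 : f 0 = 1) :
    ∃ μ : ProbabilityMeasure V, ∀ t, charFun (μ : Measure V) t = f t := by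
  set ν : Measure V := volume.withDensity fun w => ENNReal.ofReal (𝓕 f w).re
  have hν := charFun_withDensity_fourier hfc hf hpos
  have : IsFiniteMeasure ν := isFiniteMeasure_withDensity_ofReal
    (integrable_fourier_of_nonneg hf hfc.continuousAt hpos).re.2
  have hmass : ν.real Set.univ = 1 := by
    simpa [charFun_zero, h0] using hν 0
  have : IsProbabilityMeasure ν := ⟨by
    rw [← ofReal_measureReal, hmass, ENNReal.ofReal_one]⟩
  exact ⟨⟨ν.map fun w => (2 * Real.pi) • w, Measure.isProbabilityMeasure_map (by fun_prop)⟩,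
    fun t => (charFun_map_smul _ t).trans (hν t)⟩

-- Lévy's continuity theorem with an unidentified limit: tightness provides a cluster point.
theorem exists_charFun_eq_of_tendsto {μ : ℕ → ProbabilityMeasure V} (hf : ContinuousAt f 0)
    (h : ∀ t, Tendsto (fun n => charFun (μ n : Measure V) t) atTop (𝓝 (f t))) :
    ∃ ν : ProbabilityMeasure V, ∀ t, charFun (ν : Measure V) t = f t := by
  have htight := isTightMeasureSet_of_tendsto_charFun (μ := fun n => (μ n : Measure V)) hf h
  have hcompact : IsCompact (closure (Set.range μ)) :=
    isCompact_closure_of_isTightMeasureSet (by simp only [Set.exists_range_iff]; exact htight)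
  obtain ⟨ν, -, hν⟩ := hcompact.exists_mapClusterPt (u := μ) (f := atTop)
    (tendsto_principal.2 (Eventually.of_forall fun n => subset_closure (Set.mem_range_self n)))
  refine ⟨ν, fun t => ?_⟩
  have hcluster := MapClusterPt.continuousAt_comp (continuous_charFun_apply t).continuousAt hν
  exact eq_of_nhds_neBot (ClusterPt.mono hcluster (h t))

end Fourier

theorem IsPosSemidefFun.exists_charFun_eq {V : Type*} [NormedAddCommGroup V]
    [InnerProductSpace ℝ V] [FiniteDimensional ℝ V] [MeasurableSpace V] [BorelSpace V] {φ : V → ℂ}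
    (h : IsPosSemidefFun φ) (hc : Continuous φ) (h0 : φ 0 = 1) :
    ∃ μ : ProbabilityMeasure V, ∀ t, charFun (μ : Measure V) t = φ t := by
  have happrox (n : ℕ) : ∃ μ : ProbabilityMeasure V,
      ∀ t, charFun (μ : Measure V) t = Real.exp (-(n + 1 : ℝ)⁻¹ * ‖t‖ ^ 2) • φ t := by
    have hb : 0 < (n + 1 : ℝ)⁻¹ := inv_pos.2 n.cast_add_one_pos
    exact exists_charFun_eq_of_fourier_nonneg (by fun_prop) (h.integrable_gaussian_smul hc hb)
      (h.fourier_gaussian_smul_nonneg hc hb) (by simp [h0])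
  choose μ hμ using happrox
  refine exists_charFun_eq_of_tendsto (μ := μ) hc.continuousAt fun t => ?_
  simpa only [hμ, one_smul] using (tendsto_exp_neg_inv_mul (‖t‖ ^ 2)).smul_const (φ t)

section Kernel

theorem posSemidef_map_ofReal {ι : Type*} [Finite ι] {A : Matrix ι ι ℝ} (hA : A.PosSemidef) :
    (A.map Complex.ofReal).PosSemidef := by
  cases nonempty_fintype ι
  obtain ⟨m, v, rfl⟩ := Matrix.posSemidef_iff_eq_sum_vecMulVec.1 hA
  have hsum : (∑ i, Matrix.vecMulVec (v i) (star (v i))).map Complex.ofReal =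
      ∑ i, Matrix.vecMulVec (Complex.ofReal ∘ v i) (star (Complex.ofReal ∘ v i)) := by
    ext a b
    simp [Matrix.sum_apply, Matrix.vecMulVec_apply]
  rw [hsum]
  exact Matrix.posSemidef_sum _ fun i _ => Matrix.posSemidef_vecMulVec_self_star _

variable {𝒳 : Type*}

theorem IsKernel.posSemidef {k : 𝒳 → 𝒳 → ℝ} (hk : IsKernel k) {n : ℕ} (x : Fin n → 𝒳) :
    (Matrix.of fun i j => k (x i) (x j)).PosSemidef := by
  refine .of_dotProduct_mulVec_nonneg (Matrix.IsHermitian.ext fun i j => hk.symm _ _) fun a => ?_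
  simpa [dotProduct, Matrix.mulVec, Finset.mul_sum, mul_assoc, mul_comm, mul_left_comm]
    using hk.psd n x a

variable {d : ℕ} {k : Vec d → Vec d → ℝ}

theorem IsShiftInvariant.apply_eq_sub (hs : IsShiftInvariant k) (x x' : Vec d) :
    k x x' = k (x - x') 0 := by
  simpa using hs (x - x') 0 x'

theorem IsKernel.isPosSemidefFun (hk : IsKernel k) (hs : IsShiftInvariant k) :
    IsPosSemidefFun fun Δ => (k Δ 0 : ℂ) := by
  intro n x
  simp_rw [← hs.apply_eq_sub]
  exact posSemidef_map_ofReal (hk.posSemidef x)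

theorem IsKernel.existsUnique_isInverseFT (hk : IsKernel k) (hs : IsShiftInvariant k)
    (hc : Continuous (Function.uncurry k)) (h0 : k 0 0 = 1) : ∃! p, IsInverseFT k p := by
  have hc0 : Continuous fun Δ => (k Δ 0 : ℂ) :=
    Complex.continuous_ofReal.comp (hc.comp (continuous_id.prodMk continuous_const))
  obtain ⟨p, hp⟩ := (hk.isPosSemidefFun hs).exists_charFun_eq hc0 (by simp [h0])
  refine ⟨p, ⟨inferInstance, hp⟩, fun q hq => ?_⟩
  have := hq.1
  exact Measure.ext_of_charFun (funext fun Δ => (hq.2 Δ).trans (hp Δ).symm)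

end Kernel

section Moments

theorem tendsto_sub_div_sq_of_hasDerivAt_deriv {f : ℝ → ℝ} {a b : ℝ}
    (hd : ∀ᶠ t in 𝓝 a, DifferentiableAt ℝ f t) (ha : deriv f a = 0)
    (h2 : HasDerivAt (deriv f) b a) :
    Tendsto (fun t => (f t - f a) / (t - a) ^ 2) (𝓝[≠] a) (𝓝 (b / 2)) := by
  have hslope : Tendsto (fun t => deriv f t / (2 * (t - a))) (𝓝[≠] a) (𝓝 (b / 2)) := by
    refine (h2.tendsto_slope.div_const 2).congr fun t => ?_
    rw [slope_def_field, ha, sub_zero, div_div, mul_comm]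
  refine HasDerivAt.lhopital_zero_nhdsNE (f' := deriv f) (g' := fun t => 2 * (t - a)) ?_ ?_ ?_ ?_ ?_
    hslope
  · filter_upwards [nhdsWithin_le_nhds hd] with t ht using ht.hasDerivAt.sub_const _
  · exact Eventually.of_forall fun t => by
      simpa using ((hasDerivAt_id t).sub_const a).fun_pow 2
  · filter_upwards [self_mem_nhdsWithin] with t ht using mul_ne_zero two_ne_zero (sub_ne_zero.2 ht)
  · simpa using (hd.self_of_nhds.continuousAt.tendsto.sub_const (f a)).mono_left nhdsWithin_le_nhds
  · exact tendsto_nhdsWithin_of_tendsto_nhds (Continuous.tendsto' (by fun_prop) _ _ (by simp))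

theorem tendsto_one_sub_cos_mul_div_sq (x : ℝ) :
    Tendsto (fun t : ℝ => (1 - Real.cos (t * x)) / t ^ 2) (𝓝[≠] 0) (𝓝 (x ^ 2 / 2)) := by
  have hderiv : deriv (fun t : ℝ => -Real.cos (t * x)) = fun t => Real.sin (t * x) * x := by
    ext t
    simp
  have hderiv2 : HasDerivAt (deriv fun t : ℝ => -Real.cos (t * x)) (x ^ 2) 0 := by
    rw [hderiv]
    simpa [sq] using (((hasDerivAt_id (0 : ℝ)).mul_const x).sin.mul_const x)
  refine (tendsto_sub_div_sq_of_hasDerivAt_deriv (.of_forall fun t => by fun_prop)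
    (by simp [hderiv]) hderiv2).congr fun t => ?_
  simp [add_comm, sub_eq_add_neg]

-- Fatou's lemma along `2 (1 - cos (t X)) / t ^ 2`, which tends to `X ^ 2`.
theorem integrable_sq_and_integral_sq_le_of_tendsto {Ω : Type*} [MeasurableSpace Ω]
    {μ : Measure Ω} [IsProbabilityMeasure μ] {X : Ω → ℝ} (hX : AEMeasurable X μ) {b : ℝ}
    (hb : Tendsto (fun t => (1 - ∫ ω, Real.cos (t * X ω) ∂μ) / t ^ 2) (𝓝[≠] 0) (𝓝 (b / 2))) :
    Integrable (fun ω => X ω ^ 2) μ ∧ ∫ ω, X ω ^ 2 ∂μ ≤ b := by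
  have hcos (t : ℝ) : Integrable (fun ω => Real.cos (t * X ω)) μ :=
    .of_bound (Real.measurable_cos.comp_aemeasurable (hX.const_mul t)).aestronglyMeasurable 1
      (ae_of_all _ fun ω => Real.abs_cos_le_one _)
  have hseq : Tendsto (fun n : ℕ => 1 / ((n : ℝ) + 1)) atTop (𝓝[≠] 0) :=
    tendsto_nhdsWithin_iff.2 ⟨tendsto_one_div_add_atTop_nhds_zero_nat,
      .of_forall fun n => Nat.one_div_pos_of_nat.ne'⟩
  have hfatou := integrable_and_integral_le_of_tendsto_integral
    (f := fun n ω => (1 - Real.cos (1 / ((n : ℝ) + 1) * X ω)) / (1 / ((n : ℝ) + 1)) ^ 2)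
    (g := fun ω => X ω ^ 2 / 2) (fun n => ((integrable_const 1).sub (hcos _)).div_const _)
    (fun n ω => div_nonneg (sub_nonneg.2 (Real.cos_le_one _)) (sq_nonneg _))
    (fun ω => (tendsto_one_sub_cos_mul_div_sq (X ω)).comp hseq)
    ((hb.comp hseq).congr fun n => by
      rw [Function.comp_apply, integral_div, integral_sub (integrable_const 1) (hcos _)]
      simp)
  rw [integral_div] at hfatou
  exact ⟨by simpa using hfatou.1.mul_const 2, by linarith [hfatou.2]⟩

theorem integral_abs_le_sqrt {Ω : Type*} [MeasurableSpace Ω] {μ : Measure Ω}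
    [IsProbabilityMeasure μ] {X : Ω → ℝ} (hX : MemLp X 2 μ) :
    ∫ ω, |X ω| ∂μ ≤ √(∫ ω, X ω ^ 2 ∂μ) := by
  have hvar := ProbabilityTheory.variance_nonneg |X| μ
  rw [ProbabilityTheory.variance_eq_sub hX.abs] at hvar
  simp only [Pi.pow_apply, Pi.abs_apply, sq_abs] at hvar
  exact Real.le_sqrt_of_sq_le (sub_nonneg.1 hvar)

namespace IsInverseFT

variable {d : ℕ} {k : Vec d → Vec d → ℝ} {p : Measure (Vec d)}

theorem integral_cos (hp : IsInverseFT k p) (Δ : Vec d) :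
    ∫ ω, Real.cos (inner ℝ ω Δ) ∂p = k Δ 0 := by
  have := hp.1
  have hint : Integrable (fun ω : Vec d => Complex.exp ((inner ℝ ω Δ : ℝ) * Complex.I)) p :=
    .of_bound (Continuous.aestronglyMeasurable (by fun_prop)) 1
      (ae_of_all _ fun ω => by rw [Complex.norm_exp_ofReal_mul_I])
  have hre := congrArg Complex.re (hp.2 Δ)
  rw [charFun_apply, Complex.ofReal_re, ← RCLike.re_eq_complex_re, ← integral_re hint] at hre
  simpa only [RCLike.re_eq_complex_re, Complex.exp_ofReal_mul_I_re] using hre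

theorem integral_cos_mul_apply (hp : IsInverseFT k p) (i : Fin d) (t : ℝ) :
    ∫ ω, Real.cos (t * ω i) ∂p = axisRestriction k i t := by
  rw [axisRestriction, ← hp.integral_cos]
  simp [EuclideanSpace.inner_single_right]

theorem tendsto_one_sub_integral_cos_div_sq (hp : IsInverseFT k p) {i : Fin d} {b : ℝ}
    (hb : HasSecondPartialAtZero k i b) :
    Tendsto (fun t => (1 - ∫ ω, Real.cos (t * ω i) ∂p) / t ^ 2) (𝓝[≠] 0) (𝓝 (-b / 2)) := by
  have := hp.1
  have h0 : axisRestriction k i 0 = 1 := by simp [← hp.integral_cos_mul_apply]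
  have hmax : IsLocalMax (axisRestriction k i) 0 := .of_forall fun t => by
    rw [h0, ← hp.integral_cos_mul_apply]
    refine (Real.le_norm_self _).trans ?_
    simpa using norm_integral_le_of_norm_le_const (μ := p) (f := fun ω => Real.cos (t * ω i))
      (C := 1) (ae_of_all _ fun ω => Real.abs_cos_le_one (t * ω i))
  refine ((tendsto_sub_div_sq_of_hasDerivAt_deriv hb.1 hmax.deriv_eq_zero hb.2).neg.congr
    fun t => ?_).trans_eq (by rw [neg_div])
  rw [hp.integral_cos_mul_apply, h0, sub_zero, ← neg_div, neg_sub]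

theorem integrable_apply_and_integral_abs_apply_le (hp : IsInverseFT k p) {i : Fin d} {b B : ℝ}
    (hb : HasSecondPartialAtZero k i b) (hB : |b| ≤ B) :
    Integrable (fun ω => ω i) p ∧ ∫ ω, |ω i| ∂p ≤ √B := by
  have := hp.1
  have hm : Measurable fun ω : Vec d => ω i := by fun_prop
  obtain ⟨hint, hle⟩ := integrable_sq_and_integral_sq_le_of_tendsto hm.aemeasurable
    (hp.tendsto_one_sub_integral_cos_div_sq hb)
  have hLp : MemLp (fun ω : Vec d => ω i) 2 p :=
    (memLp_two_iff_integrable_sq hm.aestronglyMeasurable).2 hint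
  exact ⟨hLp.integrable one_le_two, (integral_abs_le_sqrt hLp).trans
    (Real.sqrt_le_sqrt (hle.trans ((neg_le_abs b).trans hB)))⟩

end IsInverseFT

end Moments

section Concentration

open ProbabilityTheory

variable {Ω : Type*} {m : ℕ}

/-- The empirical mean of `f` over the sample points `ω 0, …, ω (m - 1)`. The inner product
of random Fourier features at `x` and `x'` is the sample mean of `cos ⟨ω, x - x'⟩` over the
frequencies. -/
noncomputable def sampleMean (f : Ω → ℝ) (ω : Fin m → Ω) : ℝ := (∑ j, f (ω j)) / m

theorem abs_sampleMean_sub_le {f g G : Ω → ℝ} (hG : ∀ x, |f x - g x| ≤ G x) (ω : Fin m → Ω) :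
    |sampleMean f ω - sampleMean g ω| ≤ sampleMean G ω := by
  rw [sampleMean, sampleMean, ← sub_div, ← Finset.sum_sub_distrib, abs_div, Nat.abs_cast]
  exact div_le_div_of_nonneg_right
    ((Finset.abs_sum_le_sum_abs _ _).trans (Finset.sum_le_sum fun j _ => hG (ω j))) m.cast_nonneg

variable [MeasurableSpace Ω] {p : Measure Ω} [IsProbabilityMeasure p]

theorem integrable_sampleMean {f : Ω → ℝ} (hf : Integrable f p) :
    Integrable (sampleMean f) (Measure.pi fun _ : Fin m => p) :=
  (integrable_finsetSum _ fun _ _ => integrable_comp_eval hf).div_const _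

theorem integral_sampleMean (hm : 0 < m) {f : Ω → ℝ} (hf : Integrable f p) :
    ∫ ω, sampleMean f ω ∂(Measure.pi fun _ : Fin m => p) = ∫ x, f x ∂p := by
  simp only [sampleMean]
  rw [integral_div, integral_finsetSum _ fun _ _ => integrable_comp_eval hf]
  simp_rw [integral_comp_eval (μ := fun _ : Fin m => p) hf.aestronglyMeasurable]
  simp [(Nat.cast_pos.2 hm : (0 : ℝ) < m).ne']

theorem measureReal_le_sampleMean_sub_integral_le (hm : 0 < m) {f : Ω → ℝ}
    (hf : AEMeasurable f p) {a b : ℝ} (hab : ∀ᵐ x ∂p, f x ∈ Set.Icc a b) {t : ℝ} (ht : 0 ≤ t) :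
    (Measure.pi fun _ : Fin m => p).real {ω | t ≤ sampleMean f ω - ∫ x, f x ∂p} ≤
      Real.exp (-(2 * m * t ^ 2 / (b - a) ^ 2)) := by
  have hm' : (0 : ℝ) < m := Nat.cast_pos.2 hm
  have hind : iIndepFun (fun j ω => f (ω j) - ∫ x, f x ∂p) (Measure.pi fun _ : Fin m => p) :=
    iIndepFun_pi (X := fun _ x => f x - ∫ x, f x ∂p) fun _ => hf.sub_const _
  have hsub (j : Fin m) : HasSubgaussianMGF (fun ω => f (ω j) - ∫ x, f x ∂p)
      ((‖b - a‖₊ / 2) ^ 2) (Measure.pi fun _ : Fin m => p) := by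
    refine .of_map (Y := fun ω : Fin m → Ω => ω j) (X := fun x => f x - ∫ x, f x ∂p)
      (measurable_pi_apply j).aemeasurable ?_
    rw [(measurePreserving_eval (fun _ : Fin m => p) j).map_eq]
    exact hasSubgaussianMGF_of_mem_Icc hf hab
  have hsum (ω : Fin m → Ω) : ∑ j, (f (ω j) - ∫ x, f x ∂p) =
      m * (sampleMean f ω - ∫ x, f x ∂p) := by
    simp [sampleMean, mul_sub, mul_div_cancel₀ _ hm'.ne']
  have htail := HasSubgaussianMGF.measure_sum_ge_le_of_iIndepFun hind (s := Finset.univ)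
    (fun j _ => hsub j) (mul_nonneg hm'.le ht)
  simp only [hsum, mul_le_mul_iff_right₀ hm'] at htail
  refine htail.trans_eq (congrArg Real.exp ?_)
  simp only [Finset.sum_const, Finset.card_univ, Fintype.card_fin, nsmul_eq_mul, NNReal.coe_mul,
    NNReal.coe_natCast, NNReal.coe_pow, NNReal.coe_div, coe_nnnorm, NNReal.coe_ofNat,
    Real.norm_eq_abs, div_pow, sq_abs]
  rcases eq_or_ne (b - a) 0 with h | h
  · simp [h]
  · field_simp

theorem measureReal_le_abs_sampleMean_sub_integral_le (hm : 0 < m) {f : Ω → ℝ}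
    (hf : AEMeasurable f p) {a b : ℝ} (hab : ∀ᵐ x ∂p, f x ∈ Set.Icc a b) {t : ℝ} (ht : 0 ≤ t) :
    (Measure.pi fun _ : Fin m => p).real {ω | t ≤ |sampleMean f ω - ∫ x, f x ∂p|} ≤
      2 * Real.exp (-(2 * m * t ^ 2 / (b - a) ^ 2)) := by
  have hupper := measureReal_le_sampleMean_sub_integral_le hm hf hab ht
  have hlower := measureReal_le_sampleMean_sub_integral_le hm hf.neg (a := -b) (b := -a)
    (hab.mono fun x hx => ⟨neg_le_neg hx.2, neg_le_neg hx.1⟩) ht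
  have hneg (ω : Fin m → Ω) : sampleMean (-f) ω - ∫ x, (-f) x ∂p =
      -(sampleMean f ω - ∫ x, f x ∂p) := by
    simp [sampleMean, integral_neg, neg_div, add_comm, sub_eq_add_neg]
  simp only [hneg, neg_sub_neg] at hlower
  have hunion : {ω : Fin m → Ω | t ≤ |sampleMean f ω - ∫ x, f x ∂p|} =
      {ω | t ≤ sampleMean f ω - ∫ x, f x ∂p} ∪ {ω | t ≤ -(sampleMean f ω - ∫ x, f x ∂p)} :=
    by ext ω; simp only [Set.mem_union, Set.mem_ofPred_eq, le_abs]
  rw [hunion, two_mul]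
  exact (measureReal_union_le _ _).trans (add_le_add hupper hlower)

theorem measureReal_le_sampleMean_add_integral_le (hm : 0 < m) {G : Ω → ℝ} (hG0 : 0 ≤ G)
    (hG : Integrable G p) {t : ℝ} (ht : 0 < t) :
    (Measure.pi fun _ : Fin m => p).real {ω | t ≤ sampleMean G ω + ∫ x, G x ∂p} ≤
      2 * (∫ x, G x ∂p) / t := by
  have hnonneg (ω : Fin m → Ω) : 0 ≤ sampleMean G ω + ∫ x, G x ∂p :=
    add_nonneg (div_nonneg (Finset.sum_nonneg fun j _ => hG0 (ω j)) m.cast_nonneg)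
      (integral_nonneg hG0)
  have hmarkov := mul_meas_ge_le_integral_of_nonneg (ae_of_all _ hnonneg)
    ((integrable_sampleMean hG).add (integrable_const _)) t
  rw [integral_add (integrable_sampleMean hG) (integrable_const _), integral_sampleMean hm hG,
    integral_const, probReal_univ, one_smul, ← two_mul] at hmarkov
  exact (le_div_iff₀' ht).2 hmarkov

-- A union bound over the net `c`; the random modulus of continuity `G` is handled by Markov.
theorem measureReal_exists_le_abs_sampleMean_sub_integral_le (hm : 0 < m) {S ι : Type*} [Fintype ι]
    {f : S → Ω → ℝ} (hf : ∀ θ, AEMeasurable (f θ) p) {a b : ℝ}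
    (hab : ∀ θ, ∀ᵐ x ∂p, f θ x ∈ Set.Icc a b) {G : Ω → ℝ} (hG0 : 0 ≤ G) (hG : Integrable G p)
    {c : ι → S} {T : Set S} (hc : ∀ θ ∈ T, ∃ q, ∀ x, |f θ x - f (c q) x| ≤ G x)
    {ε : ℝ} (hε : 0 < ε) :
    (Measure.pi fun _ : Fin m => p).real
        {ω | ∃ θ ∈ T, ε ≤ |sampleMean (f θ) ω - ∫ x, f θ x ∂p|} ≤
      Fintype.card ι * (2 * Real.exp (-(m * ε ^ 2 / (2 * (b - a) ^ 2)))) +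
        4 * (∫ x, G x ∂p) / ε := by
  have hint (θ : S) : Integrable (f θ) p := .of_mem_Icc a b (hf θ) (hab θ)
  have hsubset : {ω : Fin m → Ω | ∃ θ ∈ T, ε ≤ |sampleMean (f θ) ω - ∫ x, f θ x ∂p|} ⊆
      (⋃ q, {ω | ε / 2 ≤ |sampleMean (f (c q)) ω - ∫ x, f (c q) x ∂p|}) ∪
        {ω | ε / 2 ≤ sampleMean G ω + ∫ x, G x ∂p} := by
    rintro ω ⟨θ, hθ, hdev⟩
    obtain ⟨q, hq⟩ := hc θ hθ
    have hmean : |∫ x, f θ x ∂p - ∫ x, f (c q) x ∂p| ≤ ∫ x, G x ∂p := by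
      rw [← integral_sub (hint _) (hint _)]
      exact abs_integral_le_integral_abs.trans
        (integral_mono ((hint _).sub (hint _)).abs hG hq)
    by_contra! hcon
    simp only [Set.mem_union, Set.mem_iUnion, Set.mem_ofPred_eq, not_or, not_exists, not_le]
      at hcon
    have hnet := abs_lt.1 (hcon.1 q)
    have hsample := abs_le.1 (abs_sampleMean_sub_le hq ω)
    have hmean := abs_le.1 hmean
    rcases le_abs.1 hdev with h | h <;> linarith [hcon.2]
  refine (measureReal_mono hsubset).trans ((measureReal_union_le _ _).trans (add_le_add ?_ ?_))
  · refine (measureReal_iUnion_fintype_le _).trans ((Finset.sum_le_card_nsmul _ _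
      (2 * Real.exp (-(m * ε ^ 2 / (2 * (b - a) ^ 2)))) fun q _ => ?_).trans_eq (by simp))
    refine (measureReal_le_abs_sampleMean_sub_integral_le hm (hf _) (hab _)
      (half_pos hε).le).trans_eq ?_
    congr 3
    rw [← div_div]
    ring
  · refine (measureReal_le_sampleMean_add_integral_le hm hG0 hG (half_pos hε)).trans_eq ?_
    ring

theorem exists_abs_sub_grid_le {N : ℕ} (hN : 0 < N) {L t : ℝ} (ht : |t| ≤ L) :
    ∃ q : Fin (N + 1), |t - (2 * L / N * q - L)| ≤ 2 * L / N := by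
  have hN' : (0 : ℝ) < N := Nat.cast_pos.2 hN
  obtain ⟨hlo, hhi⟩ := abs_le.1 ht
  rcases ((abs_nonneg t).trans ht).eq_or_lt with rfl | hL
  · exact ⟨0, by simp [abs_nonpos_iff.1 ht]⟩
  have hh : 0 < 2 * L / N := by positivity
  have hx : 0 ≤ (t + L) / (2 * L / N) := div_nonneg (by linarith) hh.le
  have hxN : (t + L) / (2 * L / N) ≤ N := by
    rw [div_le_iff₀ hh, mul_div_cancel₀ _ hN'.ne']
    linarith
  refine ⟨⟨⌊(t + L) / (2 * L / N)⌋₊, Nat.lt_succ_of_le (Nat.floor_le_of_le hxN)⟩, ?_⟩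
  have hfloor := (le_div_iff₀' hh).1 (Nat.floor_le hx)
  have hceil := (div_lt_iff₀' hh).1 (Nat.lt_floor_add_one ((t + L) / (2 * L / N)))
  rw [abs_le]
  constructor <;> linarith

theorem abs_cos_inner_sub_le {d : ℕ} {h : ℝ} {Δ c : Vec d} (hc : ∀ i, |Δ i - c i| ≤ h)
    (ω : Vec d) : |Real.cos (inner ℝ ω Δ) - Real.cos (inner ℝ ω c)| ≤ h * ∑ i, |ω i| := by
  refine (Real.abs_cos_sub_cos_le _ _).trans ?_
  rw [← inner_sub_right, PiLp.inner_apply, Finset.mul_sum]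
  refine (Finset.abs_sum_le_sum_abs _ _).trans (Finset.sum_le_sum fun i _ => ?_)
  simpa [abs_mul] using mul_le_mul_of_nonneg_right (hc i) (abs_nonneg (ω i))

theorem measureReal_exists_le_abs_sampleMean_cos_sub_integral_le {d : ℕ} {p : Measure (Vec d)}
    [IsProbabilityMeasure p] (hm : 0 < m) (hint : ∀ i, Integrable (fun ω : Vec d => ω i) p) {s : ℝ}
    (hs : ∀ i, ∫ ω, |ω i| ∂p ≤ s) {L ε : ℝ} (hL : 0 ≤ L) (hε : 0 < ε) {N : ℕ} (hN : 0 < N) :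
    (Measure.pi fun _ : Fin m => p).real {ω | ∃ Δ ∈ {Δ : Vec d | ∀ i, |Δ i| ≤ L},
        ε ≤ |sampleMean (fun ω => Real.cos (inner ℝ ω Δ)) ω - ∫ ω, Real.cos (inner ℝ ω Δ) ∂p|} ≤
      (N + 1) ^ d * (2 * Real.exp (-(m * ε ^ 2 / 8))) + 8 * (L * d * s / ε) / N := by
  have hnet (Δ : Vec d) (hΔ : ∀ i, |Δ i| ≤ L) : ∃ q : Fin d → Fin (N + 1), ∀ ω : Vec d,
      |Real.cos (inner ℝ ω Δ) - Real.cos (inner ℝ ω (WithLp.toLp 2 fun i => 2 * L / N * q i - L))|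
        ≤ 2 * L / N * ∑ i, |ω i| := by
    choose q hq using fun i => exists_abs_sub_grid_le hN (hΔ i)
    exact ⟨q, abs_cos_inner_sub_le hq⟩
  have hsum : ∫ ω, 2 * L / N * ∑ i, |ω i| ∂p ≤ 2 * L / N * (d * s) := by
    rw [integral_const_mul, integral_finsetSum _ fun i _ => (hint i).abs]
    exact mul_le_mul_of_nonneg_left
      ((Finset.sum_le_card_nsmul _ _ _ fun i _ => hs i).trans_eq (by simp)) (by positivity)
  refine (measureReal_exists_le_abs_sampleMean_sub_integral_le hm
    (fun Δ => Measurable.aemeasurable (by fun_prop))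
    (fun Δ => ae_of_all _ fun ω => Real.cos_mem_Icc _)
    (fun ω => by positivity) ((integrable_finsetSum _ fun i _ => (hint i).abs).const_mul _)
    hnet hε).trans (add_le_add (le_of_eq ?_) ?_)
  · norm_num
  · calc 4 * (∫ ω, 2 * L / N * ∑ i, |ω i| ∂p) / ε ≤ 4 * (2 * L / N * (d * s)) / ε := by gcongr
      _ = 8 * (L * d * s / ε) / N := by ring

end Concentration

section GridSize

theorem log_mul_le_mul_log {A M : ℝ} (hA : 1 ≤ A) (hM : 2 ≤ M) :
    Real.log (A * M) ≤ (1 + Real.log A / Real.log 2) * Real.log M := by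
  have hlog2 : 0 < Real.log 2 := Real.log_pos one_lt_two
  have hscale : Real.log A ≤ Real.log A / Real.log 2 * Real.log M := by
    rw [div_mul_eq_mul_div, le_div_iff₀ hlog2]
    exact mul_le_mul_of_nonneg_left (Real.log_le_log two_pos hM) (Real.log_nonneg hA)
  rw [Real.log_mul (by positivity) (by positivity)]
  linarith

theorem pow_mul_exp_neg_le {a b t : ℝ} {d : ℕ} (ha : 0 ≤ a) (hb : 0 < b)
    (h : d * Real.log b ≤ t) : a ^ d * Real.exp (-t) ≤ (a / b) ^ d := by
  have hexp : Real.exp (-t) ≤ b⁻¹ ^ d := by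
    rw [← Real.exp_log hb, ← Real.exp_neg, ← Real.exp_nat_mul, mul_neg]
    exact Real.exp_le_exp.2 (neg_le_neg h)
  rw [div_eq_mul_inv, mul_pow]
  gcongr

theorem mul_log_mul_le_of_sample_size {A M ε : ℝ} {d m : ℕ} (hA : 1 ≤ A) (hM : 2 ≤ M) (hε : ε ≠ 0)
    (hm : 16 * (1 + Real.log A / Real.log 2) * (d / ε ^ 2) * Real.log M ≤ ((2 * m : ℕ) : ℝ)) :
    d * Real.log (A * M) ≤ m * ε ^ 2 / 8 :=
  calc d * Real.log (A * M)
      ≤ d * ((1 + Real.log A / Real.log 2) * Real.log M) := by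
        gcongr
        exact log_mul_le_mul_log hA hM
    _ = 16 * (1 + Real.log A / Real.log 2) * (d / ε ^ 2) * Real.log M * (ε ^ 2 / 16) := by
        field_simp
    _ ≤ (2 * m : ℕ) * (ε ^ 2 / 16) := by gcongr
    _ = m * ε ^ 2 / 8 := by push_cast; ring

-- `N = ⌈32 max(2, Q) / δ⌉` makes each of the two error terms at most `δ / 2`.
theorem exists_grid_size {δ : ℝ} (hδ : 0 < δ) (hδ1 : δ < 1) :
    ∃ C : ℝ, 0 < C ∧ ∀ (d m : ℕ) (ε Q : ℝ), 0 < d → ε ≠ 0 →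
      C * (d / ε ^ 2) * Real.log (max 2 Q) ≤ ((2 * m : ℕ) : ℝ) →
      ∃ N : ℕ, 0 < N ∧ (N + 1) ^ d * (2 * Real.exp (-(m * ε ^ 2 / 8))) + 16 * Q / N ≤ δ := by
  have hA : 1 ≤ 136 / δ ^ 2 := (one_le_div (by positivity)).2 (by nlinarith)
  have hC : 0 < 1 + Real.log (136 / δ ^ 2) / Real.log 2 :=
    add_pos_of_pos_of_nonneg one_pos
      (div_nonneg (Real.log_nonneg hA) (Real.log_nonneg one_le_two))
  refine ⟨16 * (1 + Real.log (136 / δ ^ 2) / Real.log 2), by positivity,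
    fun d m ε Q hd hε hm => ?_⟩
  set M := max 2 Q
  have hM : 2 ≤ M := le_max_left _ _
  have hMδ : 1 ≤ M / δ := (one_le_div hδ).2 (by linarith)
  have hNlo : 32 * M / δ ≤ ⌈32 * M / δ⌉₊ := Nat.le_ceil _
  have hNhi : (⌈32 * M / δ⌉₊ + 1 : ℝ) ≤ 34 * M / δ := by
    have hceil := Nat.ceil_lt_add_one (a := 32 * M / δ) (by positivity)
    calc (⌈32 * M / δ⌉₊ + 1 : ℝ) ≤ 32 * M / δ + 2 * (M / δ) := by linarith
      _ = 34 * M / δ := by ring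
  set N := ⌈32 * M / δ⌉₊
  have hN : 0 < N := Nat.ceil_pos.2 (by positivity)
  have hgrid : 16 * Q / N ≤ δ / 2 := by
    rw [div_le_iff₀ hδ] at hNlo
    rw [div_le_iff₀ (by positivity)]
    linarith [le_max_right 2 Q]
  have hunion : (N + 1) ^ d * Real.exp (-(m * ε ^ 2 / 8)) ≤ δ / 4 := by
    calc (N + 1) ^ d * Real.exp (-(m * ε ^ 2 / 8))
        ≤ ((N + 1) / (136 / δ ^ 2 * M)) ^ d := pow_mul_exp_neg_le (by positivity) (by positivity)
          (mul_log_mul_le_of_sample_size hA hM hε hm)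
      _ ≤ (34 * M / δ / (136 / δ ^ 2 * M)) ^ d := by gcongr
      _ = (δ / 4) ^ d := by
          congr 1
          field_simp
          norm_num
      _ ≤ δ / 4 := pow_le_of_le_one (by positivity) (by linarith) hd.ne'
  exact ⟨N, hN, by linarith⟩

end GridSize

section Pauli

open Matrix

theorem isHermitian_pauli (a : Fin 4) : (pauli a).IsHermitian := by
  fin_cases a <;> ext i j <;> fin_cases i <;> fin_cases j <;> simp [pauli]

theorem pauli_mul_self (a : Fin 4) : pauli a * pauli a = 1 := by
  fin_cases a <;> ext i j <;> fin_cases i <;> fin_cases j <;> simp [pauli, Matrix.mul_apply]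

theorem trace_pauli_mul (a b : Fin 4) :
    (pauli a * pauli b).trace = if a = b then 2 else 0 := by
  split_ifs with h
  · simp [h, pauli_mul_self]
  · fin_cases a <;> fin_cases b <;> simp_all [pauli, Matrix.trace_fin_two]

variable {n : ℕ}

theorem isHermitian_pauliWord (s : Fin n → Fin 4) : (pauliWord s).IsHermitian :=
  IsHermitian.ext fun a b => by
    simp only [pauliWord, Matrix.of_apply, star_prod, (isHermitian_pauli _).apply]

theorem pauliWord_zero : pauliWord (0 : Fin n → Fin 4) = 1 := by
  ext a b
  simp [pauliWord, pauli, Matrix.one_apply, Finset.prod_ite_zero, funext_iff]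

theorem pauliWord_mul_apply (s t : Fin n → Fin 4) (a b : Fin n → Fin 2) :
    (pauliWord s * pauliWord t) a b = ∏ q, (pauli (s q) * pauli (t q)) (a q) (b q) := by
  simp only [pauliWord, Matrix.mul_apply, Matrix.of_apply, ← Finset.prod_mul_distrib]
  rw [Finset.prod_univ_sum, Fintype.piFinset_univ]

theorem pauliWord_mul_self (s : Fin n → Fin 4) : pauliWord s * pauliWord s = 1 := by
  ext a b
  simp [pauliWord_mul_apply, pauli_mul_self, Matrix.one_apply, Finset.prod_ite_zero, funext_iff]

theorem trace_pauliWord_mul (s t : Fin n → Fin 4) :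
    (pauliWord s * pauliWord t).trace = if s = t then (2 : ℂ) ^ n else 0 := by
  calc (pauliWord s * pauliWord t).trace = ∏ q, (pauli (s q) * pauli (t q)).trace := by
        simp only [Matrix.trace, Matrix.diag_apply, pauliWord_mul_apply]
        rw [Finset.prod_univ_sum, Fintype.piFinset_univ]
    _ = if s = t then (2 : ℂ) ^ n else 0 := by
        simp [trace_pauli_mul, Finset.prod_ite_zero, funext_iff]

theorem trace_nonIdPauli_mul (i j : Fin (4 ^ n - 1)) :
    (nonIdPauli n i * nonIdPauli n j).trace = if i = j then (2 : ℂ) ^ n else 0 := by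
  rw [nonIdPauli, nonIdPauli, trace_pauliWord_mul]
  simp [Fin.ext_iff]

theorem trace_nonIdPauli (i : Fin (4 ^ n - 1)) : (nonIdPauli n i).trace = 0 := by
  rw [← mul_one (nonIdPauli n i), ← pauliWord_zero, nonIdPauli, trace_pauliWord_mul, if_neg]
  simp [Equiv.symm_apply_eq, Fin.ext_iff]

variable {ι κ : Type*} [Fintype ι] [Fintype κ] [DecidableEq κ]

theorem trace_one_add_sum_smul_mul {R : Type*} [CommRing R] [DecidableEq ι]
    {P : ι → Matrix κ κ R} {c : R} (htr : ∀ i, (P i).trace = 0)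
    (hmul : ∀ i j, (P i * P j).trace = if i = j then c else 0) (a b : ι → R) :
    ((1 + ∑ i, a i • P i) * (1 + ∑ i, b i • P i)).trace =
      Fintype.card κ + c * ∑ i, a i * b i := by
  have hsum (a : ι → R) : (∑ i, a i • P i).trace = 0 := by
    simp [Matrix.trace_sum, htr]
  have hprod : ((∑ i, a i • P i) * ∑ i, b i • P i).trace = c * ∑ i, a i * b i := by
    rw [Finset.sum_mul_sum, mul_comm c, Finset.sum_mul]
    simp only [trace_sum, smul_mul_smul_comm, trace_smul, hmul, smul_eq_mul, mul_ite, mul_zero,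
      Finset.sum_ite_eq, Finset.mem_univ, if_true]
  rw [add_mul, one_mul, mul_add, mul_one, trace_add, trace_add, trace_add, trace_one, hsum, hsum,
    hprod]
  ring

theorem posSemidef_one_add_of_mul_self_eq_one {P : Matrix κ κ ℂ} (hP : P.IsHermitian)
    (hPP : P * P = 1) : (1 + P).PosSemidef := by
  have hsq : (1 + P) = (1 / 2 : ℂ) • ((1 + P)ᴴ * (1 + P)) := by
    rw [conjTranspose_add, conjTranspose_one, hP.eq, add_mul, mul_add, mul_add, hPP]
    simp only [one_mul, mul_one]
    module
  rw [hsq]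
  exact (posSemidef_conjTranspose_mul_self _).smul (by positivity)

theorem posSemidef_one_add_sign_smul {P : Matrix κ κ ℂ} (hP : P.IsHermitian) (hPP : P * P = 1)
    (s : SignType) : (1 + ((s : ℝ) : ℂ) • P).PosSemidef := by
  cases s
  · simpa using PosSemidef.one (n := κ) (R := ℂ)
  · simpa using posSemidef_one_add_of_mul_self_eq_one hP.neg (by simpa using hPP)
  · simpa using posSemidef_one_add_of_mul_self_eq_one hP hPP

end Pauli

section Embedding

variable {n D : ℕ}

theorem le_four_pow_numQubits_sub_one (D : ℕ) : D ≤ 4 ^ numQubits D - 1 :=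
  Nat.le_sub_one_of_lt (Nat.le_pow_clog (by norm_num) (D + 1))

theorem abs_pad (n : ℕ) (r : Fin D → ℝ) (i : Fin (4 ^ n - 1)) :
    |pad n r i| = pad n (fun j => |r j|) i := by
  unfold pad; split_ifs <;> simp

theorem pad_mul_pad (n : ℕ) (r s : Fin D → ℝ) (i : Fin (4 ^ n - 1)) :
    pad n r i * pad n s i = pad n (fun j => r j * s j) i := by
  unfold pad; split_ifs <;> simp

theorem sum_pad (h : D ≤ 4 ^ n - 1) (r : Fin D → ℝ) : ∑ i, pad n r i = ∑ j, r j := by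
  refine (Fintype.sum_of_injective (Fin.castLE h) (Fin.castLE_injective h) _ _ (fun i hi => ?_)
    fun j => by simp [pad]).symm
  exact dif_neg fun hlt => hi ⟨⟨i, hlt⟩, rfl⟩

theorem sum_abs_pad (h : D ≤ 4 ^ n - 1) (r : Fin D → ℝ) : ∑ i, |pad n r i| = oneNorm r := by
  simp_rw [abs_pad, sum_pad h, oneNorm]

variable {r s : Fin D → ℝ}

theorem c2qe_eq (hr : oneNorm r = 1) :
    c2qe r = (1 / 2 ^ numQubits D : ℂ) •
      (1 + ∑ i, (pad (numQubits D) r i : ℂ) • nonIdPauli (numQubits D) i) := by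
  have hmass : ∑ i, ((|pad (numQubits D) r i| : ℝ) : ℂ) = 1 := by
    rw [← Complex.ofReal_sum, sum_abs_pad (le_four_pow_numQubits_sub_one D), hr, Complex.ofReal_one]
  simp_rw [c2qe, smul_comm _ (1 / 2 ^ numQubits D : ℂ), ← Finset.smul_sum, smul_add, smul_smul,
    ← Complex.ofReal_mul, abs_mul_sign]
  rw [← smul_add, Finset.sum_add_distrib, ← Finset.sum_smul, hmass, one_smul]

theorem isDensity_c2qe (hr : oneNorm r = 1) : IsDensity (c2qe r) := by
  constructor
  · refine Matrix.posSemidef_sum _ fun i _ => Matrix.PosSemidef.smul (Matrix.PosSemidef.smul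
      (posSemidef_one_add_sign_smul (isHermitian_pauliWord _) (pauliWord_mul_self _) _) ?_) ?_
    · positivity
    · exact Complex.zero_le_real.2 (abs_nonneg _)
  · simp [c2qe_eq hr, Matrix.trace_sum, trace_nonIdPauli]

theorem two_pow_mul_eqk_c2qe {𝒳 : Type*} {f : 𝒳 → Fin D → ℝ} (hf : ∀ x, oneNorm (f x) = 1)
    (x x' : 𝒳) :
    2 ^ numQubits D * eqk (fun x => c2qe (f x)) x x' = 1 + ∑ j, f x j * f x' j := by
  have htrace : (c2qe (f x) * c2qe (f x')).trace =
      ((1 / 2 ^ numQubits D * (1 + ∑ j, f x j * f x' j) : ℝ) : ℂ) := by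
    rw [c2qe_eq (hf x), c2qe_eq (hf x'), Matrix.smul_mul, Matrix.mul_smul, Matrix.trace_smul,
      Matrix.trace_smul, trace_one_add_sum_smul_mul trace_nonIdPauli trace_nonIdPauli_mul]
    simp_rw [← Complex.ofReal_mul, pad_mul_pad, ← Complex.ofReal_sum,
      sum_pad (le_four_pow_numQubits_sub_one D)]
    simp only [Fintype.card_pi, Fintype.card_fin, Finset.prod_const, Finset.card_univ, smul_eq_mul]
    push_cast
    field_simp
  rw [eqk, htrace, Complex.ofReal_re]
  field_simp

end Embedding

section Features

variable {d m : ℕ}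

theorem sum_fin_two_mul_ite {M : Type*} [AddCommMonoid M] (f g : Fin m → M) :
    ∑ j : Fin (2 * m), (if (j : ℕ) % 2 = 0 then f ⟨(j : ℕ) / 2, by omega⟩
      else g ⟨(j : ℕ) / 2, by omega⟩) = ∑ q, (f q + g q) := by
  rw [← Fintype.sum_equiv (finProdFinEquiv.trans (finCongr (mul_comm m 2)))
    (fun z : Fin m × Fin 2 => if z.2 = 0 then f z.1 else g z.1)]
  · simp [Fintype.sum_prod_type, Fin.sum_univ_two]
  · rintro ⟨q, c⟩
    have hdiv : ((c : ℕ) + 2 * (q : ℕ)) / 2 = q := by omega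
    have hmod : ((c : ℕ) + 2 * (q : ℕ)) % 2 = c := by omega
    simp only [Equiv.trans_apply, finProdFinEquiv_apply_val, finCongr_apply, Fin.val_cast, hdiv,
      hmod, Fin.ext_iff, Fin.val_zero]

theorem inner_rff (ω : Fin m → Vec d) (x x' : Vec d) :
    inner ℝ (rff ω x) (rff ω x') = sampleMean (fun ω => Real.cos (inner ℝ ω (x - x'))) ω := by
  have hscale : √(2 / ((2 * m : ℕ) : ℝ)) * √(2 / ((2 * m : ℕ) : ℝ)) = (m : ℝ)⁻¹ := by
    rw [Real.mul_self_sqrt (by positivity)]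
    push_cast
    field_simp
  calc inner ℝ (rff ω x) (rff ω x')
      = ∑ q, ((m : ℝ)⁻¹ * (Real.cos (inner ℝ (ω q) x) * Real.cos (inner ℝ (ω q) x')) +
          (m : ℝ)⁻¹ * (Real.sin (inner ℝ (ω q) x) * Real.sin (inner ℝ (ω q) x'))) := by
        rw [← sum_fin_two_mul_ite, PiLp.inner_apply, ← hscale]
        refine Finset.sum_congr rfl fun j _ => ?_
        simp only [rff, RCLike.inner_apply, conj_trivial]
        split_ifs <;> ring
    _ = sampleMean (fun ω => Real.cos (inner ℝ ω (x - x'))) ω := by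
        simp only [sampleMean, inner_sub_right, Real.cos_sub, ← mul_add, ← Finset.mul_sum]
        ring

theorem norm_rff (hm : 0 < m) (ω : Fin m → Vec d) (x : Vec d) : ‖rff ω x‖ = 1 := by
  rw [← sq_eq_sq₀ (norm_nonneg _) zero_le_one, ← real_inner_self_eq_norm_sq, inner_rff]
  simp [sampleMean, hm.ne']

theorem oneNorm_nonneg {D : ℕ} (r : Fin D → ℝ) : 0 ≤ oneNorm r :=
  Finset.sum_nonneg fun _ _ => abs_nonneg _

theorem oneNorm_eq_zero {D : ℕ} {r : Fin D → ℝ} : oneNorm r = 0 ↔ r = 0 := by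
  simp [oneNorm, Finset.sum_eq_zero_iff_of_nonneg, funext_iff]

theorem oneNorm_div_oneNorm {D : ℕ} {r : Fin D → ℝ} (hr : oneNorm r ≠ 0) :
    oneNorm (fun j => r j / oneNorm r) = 1 := by
  simp_rw [oneNorm, abs_div, ← Finset.sum_div]
  rw [← oneNorm, abs_of_nonneg (oneNorm_nonneg r), div_self hr]

theorem oneNorm_rff_ne_zero (hm : 0 < m) (ω : Fin m → Vec d) (x : Vec d) :
    oneNorm (rff ω x) ≠ 0 := by
  intro h
  have hzero : rff ω x = 0 := PiLp.ext (congrFun (oneNorm_eq_zero.1 h))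
  simpa [hzero] using norm_rff hm ω x

theorem isDensity_qrff (hm : 0 < m) (ω : Fin m → Vec d) (x : Vec d) : IsDensity (qrff ω x) :=
  isDensity_c2qe (oneNorm_div_oneNorm (oneNorm_rff_ne_zero hm ω x))

theorem qrffKernel_eq_inner (hm : 0 < m) (ω : Fin m → Vec d) (x x' : Vec d) :
    qrffKernel ω x x' = inner ℝ (rff ω x) (rff ω x') := by
  have hne := oneNorm_rff_ne_zero hm ω
  have heqk := two_pow_mul_eqk_c2qe (fun x => oneNorm_div_oneNorm (hne x)) x x'
  rw [qrffKernel, show qrff ω = fun x => c2qe fun j => rff ω x j / oneNorm (rff ω x) from rfl, heqk,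
    add_sub_cancel_left, Finset.mul_sum, PiLp.inner_apply]
  refine Finset.sum_congr rfl fun j _ => ?_
  have := hne x
  have := hne x'
  simp only [RCLike.inner_apply, conj_trivial]
  field_simp

theorem two_pow_numQubits_le {D : ℕ} (hD : 2 ≤ D) : 2 ^ numQubits D ≤ D := by
  rcases Nat.lt_or_ge (numQubits D) 2 with hn | hn
  · exact (Nat.pow_le_pow_right two_pos (Nat.le_of_lt_succ hn)).trans hD
  · calc 2 ^ numQubits D ≤ 2 ^ (2 * (numQubits D - 1)) := Nat.pow_le_pow_right two_pos (by omega)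
      _ = 4 ^ (numQubits D - 1) := by rw [pow_mul]; norm_num
      _ ≤ D := Nat.le_of_lt_succ (Nat.pow_pred_clog_lt_self (by norm_num) (by omega))

theorem numQubits_le_two_mul_log {D : ℕ} (hD : 2 ≤ D) :
    (numQubits D : ℝ) ≤ 2 * Real.log D := by
  have hpow : (2 : ℝ) ^ numQubits D ≤ D := by exact_mod_cast two_pow_numQubits_le hD
  have hlog := Real.log_le_log (by positivity) hpow
  rw [Real.log_pow] at hlog
  nlinarith [Real.log_two_gt_d9, (numQubits D).cast_nonneg (α := ℝ)]

end Features

section UniformApproximation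

variable {d m : ℕ} {k : Vec d → Vec d → ℝ} {p : Measure (Vec d)} {X : Set (Vec d)} {R B ε : ℝ}

theorem IsInverseFT.inner_rff_sub (hp : IsInverseFT k p) (hs : IsShiftInvariant k)
    (ω : Fin m → Vec d) (x x' : Vec d) :
    inner ℝ (rff ω x) (rff ω x') - k x x' =
      sampleMean (fun ω => Real.cos (inner ℝ ω (x - x'))) ω -
        ∫ ω, Real.cos (inner ℝ ω (x - x')) ∂p := by
  rw [inner_rff, hs.apply_eq_sub, hp.integral_cos]

theorem isApproxOn_rff_of_subsingleton (hX : X.Subsingleton) (hs : IsShiftInvariant k)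
    (h0 : k 0 0 = 1) (hm : 0 < m) (hε : 0 < ε) (ω : Fin m → Vec d) :
    IsApproxOn X (fun x x' => inner ℝ (rff ω x) (rff ω x')) k ε := by
  intro x hx x' hx'
  obtain rfl := hX hx hx'
  simpa [norm_rff hm, hs.apply_eq_sub x x, h0] using hε

theorem dim_pos_and_nonneg_of_nontrivial (hX : X.Nontrivial)
    (hXR : ∀ x ∈ X, ∀ i, x i ∈ Set.Icc (-R) R) : 0 < d ∧ 0 ≤ R := by
  obtain ⟨x, hx, x', -, hne⟩ := hX
  obtain ⟨i, -⟩ : ∃ i, x i ≠ x' i := by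
    by_contra! h
    exact hne (PiLp.ext h)
  exact ⟨i.pos, by linarith [(hXR x hx i).1, (hXR x hx i).2]⟩

theorem IsInverseFT.measure_not_isApproxOn_rff_le (hp : IsInverseFT k p)
    (hs : IsShiftInvariant k) (hm : 0 < m) (hR : 0 ≤ R)
    (hXR : ∀ x ∈ X, ∀ i, x i ∈ Set.Icc (-R) R)
    (hB : ∀ i, ∃ b, HasSecondPartialAtZero k i b ∧ |b| ≤ B) (hε : 0 < ε) {N : ℕ} (hN : 0 < N) :
    (Measure.pi fun _ : Fin m => p)
        {ω | ¬ IsApproxOn X (fun x x' => inner ℝ (rff ω x) (rff ω x')) k ε} ≤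
      ENNReal.ofReal ((N + 1) ^ d * (2 * Real.exp (-(m * ε ^ 2 / 8))) +
        16 * (R * d * √B / ε) / N) := by
  have := hp.1
  have hmoment (i : Fin d) : Integrable (fun ω => ω i) p ∧ ∫ ω, |ω i| ∂p ≤ √B := by
    obtain ⟨b, hb, hbB⟩ := hB i
    exact hp.integrable_apply_and_integral_abs_apply_le hb hbB
  have hsubset : {ω : Fin m → Vec d |
        ¬ IsApproxOn X (fun x x' => inner ℝ (rff ω x) (rff ω x')) k ε} ⊆
      {ω | ∃ Δ ∈ {Δ : Vec d | ∀ i, |Δ i| ≤ 2 * R}, ε ≤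
        |sampleMean (fun ω => Real.cos (inner ℝ ω Δ)) ω - ∫ ω, Real.cos (inner ℝ ω Δ) ∂p|} := by
    intro ω hω
    simp only [IsApproxOn, Set.mem_ofPred_eq, not_forall, not_lt, hp.inner_rff_sub hs] at hω
    obtain ⟨x, hx, x', hx', hdev⟩ := hω
    refine ⟨x - x', fun i => abs_le.2 ?_, hdev⟩
    have hxi := hXR x hx i
    have hxi' := hXR x' hx' i
    constructor <;> simp only [PiLp.sub_apply] <;> linarith [hxi.1, hxi.2, hxi'.1, hxi'.2]
  refine (measure_mono hsubset).trans ?_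
  rw [← ofReal_measureReal]
  refine ENNReal.ofReal_le_ofReal
    ((measureReal_exists_le_abs_sampleMean_cos_sub_integral_le hm (fun i => (hmoment i).1)
      (fun i => (hmoment i).2) (by positivity) hε hN).trans_eq ?_)
  ring

end UniformApproximation

end QKernel

theorem corollary1_general (δ : ℝ) (hδ : 0 < δ) (hδ1 : δ < 1) :
    ∃ C : ℝ, 0 < C ∧
      ∀ (d : ℕ) (R B ε : ℝ) (X : Set (Vec d)) (k : Vec d → Vec d → ℝ),
        0 < ε →
        (∀ x ∈ X, ∀ i, x i ∈ Set.Icc (-R) R) →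
        IsKernel k →
        IsShiftInvariant k →
        Continuous (Function.uncurry k) →
        k 0 0 = 1 →
        (∀ i : Fin d, ∃ b : ℝ, HasSecondPartialAtZero k i b ∧ |b| ≤ B) →
        (∃! p : Measure (Vec d), IsInverseFT k p) ∧
        ∀ p : Measure (Vec d), IsInverseFT k p →
          ∀ m : ℕ, 0 < m →
            C * (d / ε ^ 2) * Real.log (max 2 (R * d * √B / ε)) ≤ ((2 * m : ℕ) : ℝ) →
            Measure.pi (fun _ : Fin m => p)
                {ω | ¬ (IsApproxOn X (fun x x' => inner ℝ (rff ω x) (rff ω x')) k ε ∧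
                        IsApproxOn X (qrffKernel ω) k ε)} ≤ ENNReal.ofReal δ ∧
            (∀ (ω : Fin m → Vec d) (x : Vec d), IsDensity (qrff ω x)) ∧
            (numQubits (2 * m) : ℝ) ≤ 2 * Real.log ((2 * m : ℕ) : ℝ) := by
  obtain ⟨C, hC, hgrid⟩ := exists_grid_size hδ hδ1
  refine ⟨C, hC, fun d R B ε X k hε hXR hk hs hc h0 hB =>
    ⟨hk.existsUnique_isInverseFT hs hc h0, fun p hp m hm hDC =>
      ⟨?_, isDensity_qrff hm, numQubits_le_two_mul_log (by lia)⟩⟩⟩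
  have hqrff (ω : Fin m → Vec d) :
      qrffKernel ω = fun x x' => inner ℝ (rff ω x) (rff ω x') :=
    funext₂ (qrffKernel_eq_inner hm ω)
  simp only [hqrff, and_self]
  rcases X.subsingleton_or_nontrivial with hX | hX
  · simp [isApproxOn_rff_of_subsingleton hX hs h0 hm hε]
  · obtain ⟨hd, hR⟩ := dim_pos_and_nonneg_of_nontrivial hX hXR
    obtain ⟨N, hN, hNδ⟩ := hgrid d m ε _ hd hε.ne' hDC
    exact (hp.measure_not_isApproxOn_rff_le hs hm hR hXR hB hε hN).trans
      (ENNReal.ofReal_le_ofReal hNδ)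

theorem corollary1 (δ : ℝ) (hδ : 0 < δ) (hδ1 : δ < 1) :
    ∃ C : ℝ, 0 < C ∧
      ∀ (d : ℕ) (R B ε : ℝ) (X : Set (Vec d)) (k : Vec d → Vec d → ℝ),
        0 < ε →
        IsCompact X →
        (∀ x ∈ X, ∀ i, x i ∈ Set.Icc (-R) R) →
        IsKernel k →
        IsShiftInvariant k →
        Continuous (Function.uncurry k) →
        k 0 0 = 1 →
        (∀ i : Fin d, ∃ b : ℝ, HasSecondPartialAtZero k i b ∧ |b| ≤ B) →
        (∃! p : MeasureTheory.Measure (Vec d), IsInverseFT k p) ∧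
        ∀ p : MeasureTheory.Measure (Vec d), IsInverseFT k p →
          ∀ m : ℕ, 0 < m →
            C * (d / ε ^ 2) * Real.log (max 2 (R * d * √B / ε)) ≤ ((2 * m : ℕ) : ℝ) →
            MeasureTheory.Measure.pi (fun _ : Fin m => p)
                {ω | ¬ (IsApproxOn X (fun x x' => inner ℝ (rff ω x) (rff ω x')) k ε ∧
                        IsApproxOn X (qrffKernel ω) k ε)} ≤ ENNReal.ofReal δ ∧
            (∀ (ω : Fin m → Vec d) (x : Vec d), IsDensity (qrff ω x)) ∧
            (numQubits (2 * m) : ℝ) ≤ 2 * Real.log ((2 * m : ℕ) : ℝ) := by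
  obtain ⟨C, hC, h⟩ := corollary1_general δ hδ hδ1
  exact ⟨C, hC, fun d R B ε X k hε _ => h d R B ε X k hε⟩
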